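/- A 2-edge-colored multigraph is a finite loopless multigraph each of whose edges has one of two colors (red, blue) and in which no two parallel edges have the same color. A cycle of length $k\ge 3$ consists of $k$ distinct vertices $v_1,\dots,v_k$ together with edges $v_1v_2,\dots,v_{k-1}v_k,v_kv_1$; it is proper if any two adjacent edges of it have different colors, and Hamiltonian if it contains all the vertices. Theorem. Let $n\ge 4$. (1) Let $G$ be a 2-edge-colored multigraph on $n$ vertices with $m\ge 2\binom{n-1}{2}+n$ edges. If $n$ is even, then $G$ has a proper Hamiltonian cycle; if $n$ is odd, then $G$ has a proper cycle of length $n-1$. (2) For even $n$ the bound is tight: there is a connected 2-edge-colored multigraph on $n$ vertices with exactly $2\binom{n-1}{2}+n-1$ edges and no proper Hamiltonian cycle. -/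

import Mathlib

/-- A loopless multigraph on the vertex set `V` whose edges are colored with
colors from `C` and in which no two parallel edges have the same color. As an edge is then
determined by its pair of endpoints and its color, the edges are given as a set of pairs
(unordered pair of endpoints, color). -/
structure ColoredMultigraph (V : Type*) (C : Type*) where
  /-- the set of colored edges -/
  edgeSet : Set (Sym2 V × C)
  /-- no edge is a loop -/
  loopless : ∀ e ∈ edgeSet, ¬ e.1.IsDiag

namespace ColoredMultigraph

variable {V : Type*} {C : Type*}

/-- The number `m` of edges, where parallel edges (of different colors) are counted separately. -/
noncomputable def numEdges (G : ColoredMultigraph V C) : ℕ := G.edgeSet.ncard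

/-- The simple graph of adjacency: two vertices are adjacent if some edge, of whatever color,
joins them. -/
def underlying (G : ColoredMultigraph V C) : SimpleGraph V where
  Adj x y := ∃ c, (s(x, y), c) ∈ G.edgeSet
  symm := ⟨fun x y ⟨c, h⟩ => ⟨c, Sym2.eq_swap (a := x) (b := y) ▸ h⟩⟩
  loopless := ⟨fun _ ⟨_, h⟩ => G.loopless _ h (Sym2.mk_isDiag_iff.2 rfl)⟩

/-- The multigraph is connected. -/
def Connected (G : ColoredMultigraph V C) : Prop := G.underlying.Connected

/-- A cycle of length `k ≥ 3`: pairwise distinct vertices `v 0, …, v (k - 1)` and, for each `i`,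
an edge of `G` joining `v i` to the cyclically next vertex. Since there may be parallel edges, the
edge is specified by its color. -/
structure Cycle (G : ColoredMultigraph V C) (k : ℕ) where
  three_le : 3 ≤ k
  /-- the vertices of the cycle, in cyclic order -/
  vertex : Fin k → V
  /-- the color of the edge from the `i`-th vertex to the next one -/
  color : Fin k → C
  vertex_injective : Function.Injective vertex
  edge_mem : ∀ i, (s(vertex i, vertex (finRotate k i)), color i) ∈ G.edgeSet

namespace Cycle

variable {G : ColoredMultigraph V C} {k : ℕ}

/-- The cycle is properly colored: adjacent edges of the cycle, i.e. cyclically consecutive ones,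
have different colors. -/
def IsProper (Z : G.Cycle k) : Prop := ∀ i, Z.color i ≠ Z.color (finRotate k i)

/-- The cycle contains all the vertices of the multigraph. -/
def IsHamiltonian (Z : G.Cycle k) : Prop := Function.Surjective Z.vertex

end Cycle

/-- `G` has a proper cycle of length `k`. -/
def HasProperCycle (G : ColoredMultigraph V C) (k : ℕ) : Prop := ∃ Z : G.Cycle k, Z.IsProper

/-- `G` has a proper Hamiltonian cycle. -/
def HasProperHamiltonianCycle (G : ColoredMultigraph V C) : Prop :=
  ∃ (k : ℕ) (Z : G.Cycle k), Z.IsHamiltonian ∧ Z.IsProper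

end ColoredMultigraph

/-! The proof averages over cycles. For even `k`, color the cycle along a random embedding of `Fin
k` alternately. Each color occupies `k / 2` positions, and each position is equally likely to hit
every pair, so a given colored edge is used with probability `k / (n(n-1))`. The edge bound leaves
at most `n - 2` missing edges, and `(n - 2) * k < n * (n - 1)` for `k ≤ n`, so some alternating
cycle uses none of them; take `k = n` or `k = n - 1`, whichever is even. For tightness, delete all
edges of one color at a vertex. -/

open Finset in
/-- Every edge of the complete graph is equally often the image of a given pair of indices under
an embedding of the index type into the vertex set. -/
theorem card_embedding_pair_eq {ι V : Type*} [Fintype ι] [DecidableEq ι] [Fintype V]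
    [DecidableEq V] {i j : ι} (hij : i ≠ j) {e : Sym2 V} (he : ¬ e.IsDiag) :
    (Fintype.card V).choose 2 * #{f : ι ↪ V | s(f i, f j) = e} = Fintype.card (ι ↪ V) := by
  have key : ∀ e' : Sym2 V, ¬ e'.IsDiag →
      #{f : ι ↪ V | s(f i, f j) = e'} = #{f : ι ↪ V | s(f i, f j) = e} := by
    intro e' he'
    obtain ⟨π, hπ⟩ : ∃ π : Equiv.Perm V, e'.map π = e := by
      induction e' with | _ a' b' => ?_
      induction e with | _ a b => ?_
      rw [Sym2.mk_isDiag_iff] at he he'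
      -- The first swap sends `a'` to `a`; the second corrects the image of `b'` and fixes `a`.
      refine ⟨(Equiv.swap a' a).trans (Equiv.swap (Equiv.swap a' a b') b), ?_⟩
      have h : a ≠ Equiv.swap a' a b' := fun h => he' <| by
        apply (Equiv.swap a' a).injective
        rw [← h, Equiv.swap_apply_left]
      simp [Equiv.swap_apply_of_ne_of_ne h he]
    refine card_equiv ((Equiv.refl ι).embeddingCongr π) fun f => ?_
    simp only [mem_filter, mem_univ, true_and]
    rw [← (Sym2.map.injective π.injective).eq_iff, hπ]
    simp [Equiv.embeddingCongr]
  have hmaps : Set.MapsTo (fun f : ι ↪ V => s(f i, f j)) (univ : Finset (ι ↪ V))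
      ({e : Sym2 V | ¬ e.IsDiag} : Finset (Sym2 V)) := by
    intro f _
    simpa using hij
  rw [← Sym2.card_subtype_not_diag, Fintype.card_subtype, ← smul_eq_mul, ← sum_const,
    ← card_univ (α := ι ↪ V), card_eq_sum_card_fiberwise hmaps]
  exact sum_congr rfl fun e' h => (key e' (mem_filter.1 h).2).symm

namespace ColoredMultigraph

variable {V C : Type*}

/-- The colored edges that are missing from a colored multigraph. -/
def missing (G : ColoredMultigraph V C) : Set (Sym2 V × C) := {p | ¬ p.1.IsDiag ∧ p ∉ G.edgeSet}

theorem numEdges_add_ncard_missing [Fintype V] [Fintype C] (G : ColoredMultigraph V C) :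
    G.numEdges + G.missing.ncard = (Fintype.card V).choose 2 * Fintype.card C := by
  classical
  have hd : Disjoint G.edgeSet G.missing := Set.disjoint_left.2 fun p hp hq => hq.2 hp
  have hu : G.edgeSet ∪ G.missing = {e : Sym2 V | ¬ e.IsDiag} ×ˢ (Set.univ : Set C) := by
    ext p
    have := G.loopless p
    simp only [missing, Set.mem_union, Set.mem_ofPred_eq, Set.mem_prod, Set.mem_univ, and_true]
    tauto
  rw [numEdges, ← Set.ncard_union_eq hd (Set.toFinite _) (Set.toFinite _), hu, Set.ncard_prod,
    Set.ncard_univ, Nat.card_eq_fintype_card, ← Sym2.card_subtype_not_diag,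
    ← Nat.card_eq_fintype_card (α := {e : Sym2 V // ¬ e.IsDiag})]
  rfl

/-- The coloring of the edges of a cycle by the parities of their positions. -/
def parityColor (k : ℕ) (i : Fin k) : Fin 2 := Fin.ofNat 2 i

/-- Evenness matters only at the wrap-around, where reduction mod `k` must preserve parity. -/
theorem parityColor_finRotate {k : ℕ} (hk : Even k) (i : Fin k) :
    parityColor k (finRotate k i) = parityColor k i + 1 := by
  obtain _ | m := k
  · exact i.elim0
  rw [finRotate_apply]
  ext
  simp only [parityColor, Fin.val_add, Fin.val_one', Fin.ofNat]
  rw [Nat.add_mod_mod, Nat.mod_mod_of_dvd _ hk.two_dvd, Nat.mod_add_mod]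

open Finset in
theorem two_mul_card_parityColor_eq {k : ℕ} (hk : Even k) (c : Fin 2) :
    2 * #{i : Fin k | parityColor k i = c} = k := by
  have h : #{i : Fin k | parityColor k i = c} = #{i : Fin k | ¬ parityColor k i = c} := by
    -- Rotation exchanges the two color classes.
    refine card_equiv (finRotate k) fun i => ?_
    simp only [mem_filter, mem_univ, true_and, parityColor_finRotate hk]
    generalize parityColor k i = x
    revert x c
    decide
  have := card_filter_add_card_filter_not (s := (univ : Finset (Fin k)))
    (fun i => parityColor k i = c)
  rw [card_univ, Fintype.card_fin] at this
  omega

open Finset in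
/-- By averaging over all alternately colored cycles of length `k` in the complete 2-edge-colored
multigraph, one of them avoids the missing edges if there are few of those. -/
theorem hasProperCycle_of_ncard_missing_mul_lt [Fintype V] (G : ColoredMultigraph V (Fin 2))
    {k : ℕ} (hk : Even k) (hk3 : 3 ≤ k) (hkV : k ≤ Fintype.card V)
    (hM : G.missing.ncard * k < 2 * (Fintype.card V).choose 2) : G.HasProperCycle k := by
  classical
  by_contra hG
  have hrot : ∀ i : Fin k, i ≠ finRotate k i := by
    intro i h
    have := parityColor_finRotate hk i
    rw [← h] at this
    revert this
    generalize parityColor k i = x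
    revert x
    decide
  have hbad : ∀ f : Fin k ↪ V, ∃ i, (s(f i, f (finRotate k i)), parityColor k i) ∉ G.edgeSet := by
    intro f
    by_contra! hf
    refine hG ⟨⟨hk3, f, parityColor k, f.injective, hf⟩, fun i => ?_⟩
    change parityColor k i ≠ parityColor k (finRotate k i)
    rw [parityColor_finRotate hk]
    generalize parityColor k i = x
    revert x
    decide
  set N := Fintype.card (Fin k ↪ V) with hN
  have hNpos : 0 < N := by
    have : Nonempty (Fin k ↪ V) := Function.Embedding.nonempty_of_card_le (by simpa using hkV)
    exact Fintype.card_pos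
  -- Union bound: each embedding puts a missing edge at some position of matching color.
  have hcover : (univ : Finset (Fin k ↪ V)) ⊆ G.missing.toFinset.biUnion fun p =>
      ({i : Fin k | parityColor k i = p.2} : Finset (Fin k)).biUnion fun i =>
        {f : Fin k ↪ V | s(f i, f (finRotate k i)) = p.1} := by
    intro f _
    obtain ⟨i, hi⟩ := hbad f
    simp only [mem_biUnion, mem_filter, mem_univ, true_and, Set.mem_toFinset]
    exact ⟨_, ⟨by simpa using hrot i, hi⟩, i, rfl, rfl⟩
  have hle : 2 * (Fintype.card V).choose 2 * N ≤ G.missing.ncard * k * N := by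
    calc 2 * (Fintype.card V).choose 2 * N
        ≤ 2 * (Fintype.card V).choose 2 * ∑ p ∈ G.missing.toFinset,
            ∑ i ∈ ({i : Fin k | parityColor k i = p.2} : Finset (Fin k)),
              #{f : Fin k ↪ V | s(f i, f (finRotate k i)) = p.1} :=
          Nat.mul_le_mul_left _ <| (card_le_card hcover).trans <| card_biUnion_le.trans <|
            sum_le_sum fun p _ => card_biUnion_le
      _ = ∑ p ∈ G.missing.toFinset, k * N := by
          rw [mul_sum]
          refine sum_congr rfl fun p hp => ?_
          -- The binomial factor turns each position's count into `N`; the factor 2 turns the number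
          -- of positions of one color into `k`.
          rw [mul_assoc, mul_sum, sum_congr rfl fun i _ => card_embedding_pair_eq (hrot i)
            (Set.mem_toFinset.1 hp).1, sum_const, smul_eq_mul, ← mul_assoc,
            two_mul_card_parityColor_eq hk]
      _ = G.missing.ncard * k * N := by
          rw [sum_const, smul_eq_mul, Set.ncard_eq_toFinset_card', mul_assoc]
  exact absurd (Nat.le_of_mul_le_mul_right hle hNpos) (not_le.2 hM)

theorem HasProperCycle.hasProperHamiltonianCycle [Fintype V] {G : ColoredMultigraph V C}
    (h : G.HasProperCycle (Fintype.card V)) : G.HasProperHamiltonianCycle := by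
  obtain ⟨Z, hZ⟩ := h
  exact ⟨_, Z, ((Fintype.bijective_iff_injective_and_card _).2
    ⟨Z.vertex_injective, Fintype.card_fin _⟩).2, hZ⟩

/-- The 2-edge-colored multigraph with all edges but those of color `1` at the vertex `v`. -/
def monochromaticAt (v : V) : ColoredMultigraph V (Fin 2) where
  edgeSet := {p | ¬ p.1.IsDiag ∧ (v ∈ p.1 → p.2 = 0)}
  loopless _ h := h.1

theorem connected_monochromaticAt (v : V) : (monochromaticAt v).Connected := by
  have : Nonempty V := ⟨v⟩
  refine ⟨fun x y => ?_⟩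
  obtain rfl | hxy := eq_or_ne x y
  · rfl
  · exact SimpleGraph.Adj.reachable ⟨0, by simpa using hxy, fun _ => rfl⟩

theorem ncard_missing_monochromaticAt [Fintype V] (v : V) :
    (monochromaticAt v).missing.ncard = Fintype.card V - 1 := by
  have h : (monochromaticAt v).missing = (fun w => (s(v, w), (1 : Fin 2))) '' {v}ᶜ := by
    ext ⟨e, c⟩
    simp only [missing, monochromaticAt, Set.mem_ofPred_eq, Set.mem_image, Set.mem_compl_iff,
      Set.mem_singleton_iff, Prod.mk.injEq]
    constructor
    · rintro ⟨he, h⟩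
      have h' : v ∈ e ∧ c ≠ 0 := by tauto
      obtain ⟨w, rfl⟩ := h'.1
      exact ⟨w, fun hw => he (by simp [hw]), rfl, by omega⟩
    · rintro ⟨w, hw, rfl, rfl⟩
      exact ⟨by simpa using Ne.symm hw, by simp⟩
  rw [h, Set.ncard_image_of_injective _ fun w w' hw => Sym2.congr_right.1 (Prod.ext_iff.1 hw).1,
    Set.ncard_compl,
    Set.ncard_singleton, Nat.card_eq_fintype_card]

/-- Both cycle edges at `v` would have color `0`. -/
theorem not_hasProperHamiltonianCycle_monochromaticAt (v : V) :
    ¬ (monochromaticAt v).HasProperHamiltonianCycle := by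
  rintro ⟨k, Z, hham, hproper⟩
  obtain ⟨i, hi⟩ := hham v
  obtain ⟨j, rfl⟩ := (finRotate k).surjective i
  apply hproper j
  have h₁ : Z.color j = 0 := (Z.edge_mem j).2 (Sym2.mem_iff.2 (Or.inr hi.symm))
  have h₂ : Z.color (finRotate k j) = 0 :=
    (Z.edge_mem (finRotate k j)).2 (Sym2.mem_iff.2 (Or.inl hi.symm))
  rw [h₁, h₂]

end ColoredMultigraph

theorem theorem2 {V : Type*} [Fintype V] (hn : 4 ≤ Fintype.card V) :
    (∀ G : ColoredMultigraph V (Fin 2),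
      2 * (Fintype.card V - 1).choose 2 + Fintype.card V ≤ G.numEdges →
        (Even (Fintype.card V) → G.HasProperHamiltonianCycle) ∧
        (Odd (Fintype.card V) → G.HasProperCycle (Fintype.card V - 1))) ∧
    (Even (Fintype.card V) →
      ∃ G : ColoredMultigraph V (Fin 2), G.Connected ∧
        G.numEdges = 2 * (Fintype.card V - 1).choose 2 + Fintype.card V - 1 ∧
        ¬ G.HasProperHamiltonianCycle) := by
  obtain ⟨m, hm⟩ : ∃ m, Fintype.card V = m + 2 := ⟨Fintype.card V - 2, by omega⟩
  have hch : 2 * (Fintype.card V).choose 2 = (m + 2) * (m + 1) := by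
    rw [hm, mul_comm, Nat.choose_two_right]
    exact Nat.div_mul_cancel (Nat.even_mul_pred_self _).two_dvd
  have hch' : 2 * (Fintype.card V - 1).choose 2 = (m + 1) * m := by
    rw [hm, mul_comm, Nat.choose_two_right]
    exact Nat.div_mul_cancel (Nat.even_mul_pred_self _).two_dvd
  refine ⟨fun G hG => ?_, fun _ => ?_⟩
  · have hcount := G.numEdges_add_ncard_missing
    rw [Fintype.card_fin, mul_comm, hch] at hcount
    -- With `n = m + 2`, this is `(m+2)(m+1) - (m+1)m - (m+2) = m`.
    have hM : G.missing.ncard ≤ m := by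
      rw [hch', hm] at hG
      nlinarith
    refine ⟨fun he => ColoredMultigraph.HasProperCycle.hasProperHamiltonianCycle ?_, fun ho => ?_⟩
    · refine G.hasProperCycle_of_ncard_missing_mul_lt he (by omega) le_rfl ?_
      rw [hch, hm]
      nlinarith
    · refine G.hasProperCycle_of_ncard_missing_mul_lt
        (Nat.Odd.sub_odd ho odd_one) (by omega) (Nat.sub_le _ _) ?_
      rw [hch, hm, Nat.add_sub_assoc (by norm_num)]
      nlinarith
  · obtain ⟨v⟩ : Nonempty V := Fintype.card_pos_iff.1 (by omega)
    refine ⟨ColoredMultigraph.monochromaticAt v, ColoredMultigraph.connected_monochromaticAt v, ?_,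
      ColoredMultigraph.not_hasProperHamiltonianCycle_monochromaticAt v⟩
    have hcount := (ColoredMultigraph.monochromaticAt v).numEdges_add_ncard_missing
    rw [Fintype.card_fin, mul_comm, hch, ColoredMultigraph.ncard_missing_monochromaticAt] at hcount
    rw [hch']
    have : (m + 2) * (m + 1) = (m + 1) * m + 2 * (m + 1) := by ring
    omega
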